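/- **Setting.** Let $1\le d<p$ and $d\le r$ be integers, $\mu\in\mathbb R^p$, $\sigma\in\mathbb R$, let $\Gamma$ be a $p\times d$ matrix with $\Gamma^T\Gamma=I_d$ and $\beta$ a $d\times r$ matrix. On one probability space suppose that for each sample size $n$ we have a random $n\times r$ matrix $F=F_n$ with rows $f_i^T$ and $\sum_{i=1}^n f_i=0$ almost surely, and, independent of $F_n$, an $n\times p$ matrix of independent standard normal errors with rows $\varepsilon_i^T$. The observations are $$X_i=\mu+\Gamma\beta f_i+\sigma\varepsilon_i\in\mathbb R^p,\qquad i=1,\dots,n.$$ Let $\mathbb X$ be the $n\times p$ matrix with rows $(X_i-\bar X)^T$, where $\bar X$ is the sample mean. For a matrix $G$ let $P_G$ be the orthogonal projection onto the span of its columns (so $P_G=G(G^TG)^{-1}G^T$ if $G$ has full column rank), and put $\widehat{\mathbb X}=P_F\mathbb X$. A PFC estimate $\widehat\Gamma_{\mathrm{PFC}}$ of $\Gamma$ is a $p\times d$ matrix whose columns are $d$ linearly independent eigenvectors, of arbitrary lengths, of $\widehat{\mathbb X}^T\widehat{\mathbb X}$ corresponding to its $d$ largest eigenvalues (counted with multiplicity).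 The angle $\Theta(\widehat\Gamma,\Gamma)\in[0,\pi/2]$ is defined by $$\cot^2\Theta(\widehat\Gamma,\Gamma)=C(\widehat\Gamma,\Gamma)=\frac{\|P_\Gamma\widehat\Gamma\|_F^2}{\|(I_p-P_\Gamma)\widehat\Gamma\|_F^2}\in[0,\infty],$$ with $\|\cdot\|_F$ the Frobenius norm and $\cot 0=\infty$. **Theorem 4.3.** Suppose that, almost surely, $\beta(F^TF)\beta^T/n$ converges as $n\to\infty$ to a deterministic $d\times d$ matrix $\Phi$ whose eigenvalues are distinct and positive. Then for each $\alpha\in(0,1)$ there are deterministic bounds $\Theta^*(\alpha)=\Theta^*_n(\alpha)$ with $\Theta^*_n(\alpha)=O(1/\sqrt n)$ as $n\to\infty$ such that, for every $n$ and every choice of the PFC estimate, $$\mathbb P\bigl(\Theta(\widehat\Gamma_{\mathrm{PFC}},\Gamma)\ge\Theta^*_n(\alpha)\bigr)\le\alpha .$$ -/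

import Mathlib

open MeasureTheory ProbabilityTheory Filter Topology Asymptotics Matrix
open scoped ENNReal

noncomputable section

namespace PFC

/-- The matrix `P_G` of the orthogonal projection of `ℝ^m` (with its Euclidean inner product)
onto the span of the columns of the `m × k` matrix `G`. -/
def projMatrix {m k : ℕ} (G : Matrix (Fin m) (Fin k) ℝ) : Matrix (Fin m) (Fin m) ℝ :=
  (Matrix.toEuclideanCLM (n := Fin m) (𝕜 := ℝ)).symm
    (LinearMap.range (Matrix.toEuclideanLin G)).starProjection

/-- If `G` has full column rank, then `P_G = G (Gᵀ G)⁻¹ Gᵀ`. -/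
theorem projMatrix_eq {m k : ℕ} (G : Matrix (Fin m) (Fin k) ℝ) (hG : IsUnit (Gᵀ * G).det) :
    projMatrix G = G * (Gᵀ * G)⁻¹ * Gᵀ := by
  rw [projMatrix, ← (Matrix.toEuclideanCLM (n := Fin m) (𝕜 := ℝ)).symm_apply_apply
    (G * (Gᵀ * G)⁻¹ * Gᵀ)]
  congr 1
  refine ContinuousLinearMap.ext fun x => ?_
  refine Submodule.eq_starProjection_of_mem_of_inner_eq_zero ?_ ?_
  · refine ⟨WithLp.toLp 2 (((Gᵀ * G)⁻¹ * Gᵀ) *ᵥ x.ofLp), ?_⟩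
    apply WithLp.ofLp_injective
    simp [Matrix.ofLp_toEuclideanCLM, Matrix.mul_assoc]
  · rintro _ ⟨w, rfl⟩
    have key : (x.ofLp - (G * (Gᵀ * G)⁻¹ * Gᵀ) *ᵥ x.ofLp) ᵥ* G = 0 := by
      rw [← Matrix.mulVec_transpose, Matrix.mulVec_sub, Matrix.mulVec_mulVec,
        ← Matrix.mul_assoc, ← Matrix.mul_assoc, Matrix.mul_nonsing_inv _ hG, Matrix.one_mul,
        sub_self]
    rw [EuclideanSpace.inner_eq_star_dotProduct, dotProduct_comm]
    simp [Matrix.ofLp_toLpLin, Matrix.ofLp_toEuclideanCLM, Matrix.dotProduct_mulVec, key]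

/-- The `n × p` matrix whose `i`-th row is the transpose of the observation
`μ + Γ β f_i + σ ε_i`, where `f_i` and `ε_i` are the `i`-th rows of `F` and `ε`. -/
def observations {n p d r : ℕ} (μ : Fin p → ℝ) (Γ : Matrix (Fin p) (Fin d) ℝ)
    (β : Matrix (Fin d) (Fin r) ℝ) (σ : ℝ) (F : Matrix (Fin n) (Fin r) ℝ)
    (ε : Matrix (Fin n) (Fin p) ℝ) : Matrix (Fin n) (Fin p) ℝ :=
  Matrix.of fun i => μ + (Γ * β) *ᵥ (F i) + σ • ε i

/-- Subtract the sample mean from every row. -/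
def centred {n p : ℕ} (X : Matrix (Fin n) (Fin p) ℝ) : Matrix (Fin n) (Fin p) ℝ :=
  Matrix.of fun i k => X i k - (∑ j, X j k) / n

/-- The fitted matrix of predictors: the projection, by `P_F`, of the centred observations. -/
def fitted {n p r : ℕ} (F : Matrix (Fin n) (Fin r) ℝ) (X : Matrix (Fin n) (Fin p) ℝ) :
    Matrix (Fin n) (Fin p) ℝ :=
  projMatrix F * centred X

/-- The fitted sample covariance matrix (unnormalised). -/
def fittedCov {n p r : ℕ} (F : Matrix (Fin n) (Fin r) ℝ) (X : Matrix (Fin n) (Fin p) ℝ) :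
    Matrix (Fin p) (Fin p) ℝ :=
  (fitted F X)ᵀ * fitted F X

theorem fittedCov_isHermitian {n p r : ℕ} (F : Matrix (Fin n) (Fin r) ℝ)
    (X : Matrix (Fin n) (Fin p) ℝ) : (fittedCov F X).IsHermitian :=
  isHermitian_conjTranspose_mul_self (fitted F X)

/-- The eigenvalues of a symmetric matrix, with multiplicity, in decreasing order:
`sortedEigenvalue hA 0 ≥ sortedEigenvalue hA 1 ≥ …`. -/
def sortedEigenvalue {p : ℕ} {A : Matrix (Fin p) (Fin p) ℝ} (hA : A.IsHermitian) (j : Fin p) : ℝ :=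
  hA.eigenvalues₀ (Fin.cast (Fintype.card_fin p).symm j)

/-- The columns of the `p × d` matrix `Ghat` are a PFC estimate computed from `F` and the
observations `X`: they are linearly independent, and the `j`-th one is an eigenvector of the fitted
sample covariance matrix for its `j`-th largest eigenvalue (`j ≤ d`). The columns may have arbitrary
lengths. -/
def IsPFCEstimate {n p d r : ℕ} (hdp : d ≤ p) (F : Matrix (Fin n) (Fin r) ℝ)
    (X : Matrix (Fin n) (Fin p) ℝ) (Ghat : Matrix (Fin p) (Fin d) ℝ) : Prop :=
  LinearIndependent ℝ Ghatᵀ ∧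
    ∀ j : Fin d, fittedCov F X *ᵥ Ghatᵀ j =
      sortedEigenvalue (fittedCov_isHermitian F X) (Fin.castLE hdp j) • Ghatᵀ j

/-- The square of the Frobenius norm, `tr (A Aᵀ)`. -/
def frobSq {m k : ℕ} (A : Matrix (Fin m) (Fin k) ℝ) : ℝ := (A * Aᵀ).trace

/-- `C(Ghat, Γ) = ‖P_Γ Ghat‖_F² / ‖(I - P_Γ) Ghat‖_F²`, an element of `[0, ∞]`; it is `∞` when
`Ghat ≠ 0` has all its columns in the span of the columns of `Γ`. -/
def closeness {p d : ℕ} (Ghat Γ : Matrix (Fin p) (Fin d) ℝ) : ℝ≥0∞ :=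
  ENNReal.ofReal (frobSq (projMatrix Γ * Ghat)) /
    ENNReal.ofReal (frobSq ((1 - projMatrix Γ) * Ghat))

/-- The angle `Θ(Ghat, Γ) ∈ [0, π/2]` with `cot² Θ(Ghat, Γ) = C(Ghat, Γ)`, where `cot 0 = ∞`. -/
def angle {p d : ℕ} (Ghat Γ : Matrix (Fin p) (Fin d) ℝ) : ℝ :=
  if closeness Ghat Γ = 0 then Real.pi / 2
  else Real.arctan (Real.sqrt ((closeness Ghat Γ)⁻¹).toReal)

end PFC

end

/-! The columns of `F` sum to zero, so `P_F` removes the mean and the fitted matrix is `F βᵀ Γᵀ + E`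
with `E = σ P_F ε`. Its signal has rows in the span of `Γ` and squared size of order `n`. The noise
stays bounded in probability: `P_F` has rank at most `r` and is independent of `ε`, so `‖P_F ε‖²`
has mean at most `p r`. The rest is deterministic perturbation. By min-max on the span of `Γ`, the
`d` leading eigenvalues are at least `c` once the signal form is at least `4c` and `‖E‖² ≤ c`
(`le_sortedEigenvalue_fittedCov`). The complement of `P_Γ` kills the signal, so an eigenvector `v`
for such an eigenvalue leaves a residual of squared norm at most `‖E‖² ‖v‖² / c`
(`eigenvector_residual_le`). With `c` of order `n` the angle is `O(1/√n)`, outside two events of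
probability at most `α/2`: large projected noise (Markov) and a signal matrix far from `Φ` (almost
sure convergence). -/

namespace PFC

/-! ### Algebra of the orthogonal projection matrix. -/

section Projection

variable {m k : ℕ}

theorem toEuclideanCLM_projMatrix (G : Matrix (Fin m) (Fin k) ℝ) :
    Matrix.toEuclideanCLM (n := Fin m) (𝕜 := ℝ) (projMatrix G) =
      (LinearMap.range (Matrix.toEuclideanLin G)).starProjection := by
  simp [projMatrix]

theorem projMatrix_mulVec (G : Matrix (Fin m) (Fin k) ℝ) (x : Fin m → ℝ) :
    projMatrix G *ᵥ x =
      ((LinearMap.range (Matrix.toEuclideanLin G)).starProjection (WithLp.toLp 2 x)).ofLp := by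
  rw [← toEuclideanCLM_projMatrix, Matrix.ofLp_toEuclideanCLM]

theorem projMatrix_mulVec_mulVec (G : Matrix (Fin m) (Fin k) ℝ) (u : Fin k → ℝ) :
    projMatrix G *ᵥ (G *ᵥ u) = G *ᵥ u := by
  rw [projMatrix_mulVec, Submodule.starProjection_eq_self_iff.2]
  exact ⟨WithLp.toLp 2 u, rfl⟩

theorem exists_projMatrix_mulVec (G : Matrix (Fin m) (Fin k) ℝ) (x : Fin m → ℝ) :
    ∃ u, projMatrix G *ᵥ x = G *ᵥ u := by
  rw [projMatrix_mulVec]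
  obtain ⟨u, hu⟩ := Submodule.starProjection_apply_mem
    (LinearMap.range (Matrix.toEuclideanLin G)) (WithLp.toLp 2 x)
  exact ⟨u.ofLp, by rw [← hu]; rfl⟩

theorem projMatrix_mul_self (G : Matrix (Fin m) (Fin k) ℝ) : projMatrix G * G = G := by
  refine Matrix.ext_iff_mulVec.2 fun u => ?_
  rw [← mulVec_mulVec, projMatrix_mulVec_mulVec]

theorem projMatrix_transpose (G : Matrix (Fin m) (Fin k) ℝ) : (projMatrix G)ᵀ = projMatrix G := by
  have h : star (projMatrix G) = projMatrix G := by
    apply EquivLike.injective (Matrix.toEuclideanCLM (n := Fin m) (𝕜 := ℝ))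
    rw [map_star, toEuclideanCLM_projMatrix]
    exact isSelfAdjoint_starProjection _
  simpa [star_eq_conjTranspose] using h

theorem projMatrix_mul_projMatrix (G : Matrix (Fin m) (Fin k) ℝ) :
    projMatrix G * projMatrix G = projMatrix G := by
  refine Matrix.ext_iff_mulVec.2 fun x => ?_
  obtain ⟨u, hu⟩ := exists_projMatrix_mulVec G x
  rw [← mulVec_mulVec, hu, projMatrix_mulVec_mulVec]

theorem projMatrix_mulVec_eq_zero (G : Matrix (Fin m) (Fin k) ℝ) {x : Fin m → ℝ}
    (hx : Gᵀ *ᵥ x = 0) : projMatrix G *ᵥ x = 0 := by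
  obtain ⟨u, hu⟩ := exists_projMatrix_mulVec G x
  have h : (projMatrix G *ᵥ x) ⬝ᵥ (projMatrix G *ᵥ x) = 0 := by
    nth_rw 1 [← projMatrix_transpose]
    rw [mulVec_transpose, ← dotProduct_mulVec, mulVec_mulVec, projMatrix_mul_projMatrix, hu,
      dotProduct_mulVec, ← mulVec_transpose, hx, zero_dotProduct]
  exact dotProduct_self_eq_zero.1 h

theorem dotProduct_projMatrix_mulVec (G : Matrix (Fin m) (Fin k) ℝ) (x : Fin m → ℝ)
    (u : Fin k → ℝ) : (G *ᵥ u) ⬝ᵥ (projMatrix G *ᵥ x) = (G *ᵥ u) ⬝ᵥ x := by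
  rw [dotProduct_mulVec, ← mulVec_transpose, projMatrix_transpose, projMatrix_mulVec_mulVec]

/-- The trace of a projection is its rank. -/
theorem trace_projMatrix_le (G : Matrix (Fin m) (Fin k) ℝ) : (projMatrix G).trace ≤ k := by
  have h1 : (projMatrix G).trace =
      Module.finrank ℝ (LinearMap.range (Matrix.toLin' G)) := by
    have : LinearMap.IsProj (LinearMap.range (Matrix.toLin' G)) (Matrix.toLin' (projMatrix G)) := by
      constructor
      · intro x
        obtain ⟨u, hu⟩ := exists_projMatrix_mulVec G x
        exact ⟨u, by simpa using hu.symm⟩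
      · rintro _ ⟨u, rfl⟩
        simp only [toLin'_apply, projMatrix_mulVec_mulVec]
    rw [← this.trace, Matrix.trace_toLin'_eq]
  rw [h1]
  exact_mod_cast (LinearMap.finrank_range_le _).trans (by simp)

end Projection

/-! ### The Frobenius norm. -/

section Frobenius

variable {m k l : ℕ}

theorem frobSq_eq_sum_sq (A : Matrix (Fin m) (Fin k) ℝ) : frobSq A = ∑ i, ∑ j, A i j ^ 2 := by
  simp [frobSq, Matrix.trace, Matrix.mul_apply, sq]

theorem frobSq_nonneg (A : Matrix (Fin m) (Fin k) ℝ) : 0 ≤ frobSq A := by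
  rw [frobSq_eq_sum_sq]; positivity

theorem frobSq_eq_sum_col (A : Matrix (Fin m) (Fin k) ℝ) :
    frobSq A = ∑ j, (Aᵀ j) ⬝ᵥ (Aᵀ j) := by
  rw [frobSq_eq_sum_sq, Finset.sum_comm]
  simp [dotProduct, sq]

theorem mul_transpose_row (A : Matrix (Fin m) (Fin k) ℝ) (B : Matrix (Fin k) (Fin l) ℝ)
    (j : Fin l) : (A * B)ᵀ j = A *ᵥ (Bᵀ j) := by
  ext i; simp [Matrix.mul_apply, mulVec, dotProduct]

theorem frobSq_transpose (A : Matrix (Fin m) (Fin k) ℝ) : frobSq Aᵀ = frobSq A := by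
  rw [frobSq, frobSq, transpose_transpose, trace_mul_comm]

theorem frobSq_smul (c : ℝ) (A : Matrix (Fin m) (Fin k) ℝ) : frobSq (c • A) = c ^ 2 * frobSq A := by
  simp only [frobSq_eq_sum_sq, Matrix.smul_apply, smul_eq_mul, mul_pow, Finset.mul_sum]

theorem dotProduct_mulVec_self_le (A : Matrix (Fin m) (Fin k) ℝ) (x : Fin k → ℝ) :
    (A *ᵥ x) ⬝ᵥ (A *ᵥ x) ≤ frobSq A * (x ⬝ᵥ x) := by
  rw [frobSq_eq_sum_sq, Finset.sum_mul, dotProduct]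
  refine Finset.sum_le_sum fun i _ => ?_
  have := Finset.sum_mul_sq_le_sq_mul_sq Finset.univ (A i) x
  simpa [mulVec, dotProduct, sq] using this

theorem zero_le_dotProduct_self (x : Fin m → ℝ) : 0 ≤ x ⬝ᵥ x :=
  Finset.sum_nonneg fun i _ => mul_self_nonneg (x i)

theorem frobSq_projMatrix_le (G : Matrix (Fin m) (Fin k) ℝ) : frobSq (projMatrix G) ≤ k := by
  rw [frobSq, projMatrix_transpose, projMatrix_mul_projMatrix]
  exact trace_projMatrix_le G

end Frobenius

/-! ### Perturbation of eigenvectors and the min-max bound. -/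

section Spectral

variable {n p d : ℕ}

theorem dotProduct_mulVec_mulVec (A : Matrix (Fin n) (Fin p) ℝ) (x : Fin p → ℝ) :
    x ⬝ᵥ ((Aᵀ * A) *ᵥ x) = (A *ᵥ x) ⬝ᵥ (A *ᵥ x) := by
  rw [← mulVec_mulVec, dotProduct_mulVec, vecMul_transpose]

theorem dotProduct_self_mulVec_of_orthonormal {Γ : Matrix (Fin p) (Fin d) ℝ} (hΓ : Γᵀ * Γ = 1)
    (u : Fin d → ℝ) : (Γ *ᵥ u) ⬝ᵥ (Γ *ᵥ u) = u ⬝ᵥ u := by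
  rw [← dotProduct_mulVec_mulVec, hΓ, one_mulVec]

/-- The norm of a vector is the sum of those of its projections onto the span of the columns of `G`
and onto the orthogonal complement. -/
theorem dotProduct_self_projMatrix_add (G : Matrix (Fin p) (Fin d) ℝ) (v : Fin p → ℝ) :
    (projMatrix G *ᵥ v) ⬝ᵥ (projMatrix G *ᵥ v) +
      ((1 - projMatrix G) *ᵥ v) ⬝ᵥ ((1 - projMatrix G) *ᵥ v) = v ⬝ᵥ v := by
  obtain ⟨u, hu⟩ := exists_projMatrix_mulVec G v
  have h := dotProduct_projMatrix_mulVec G v u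
  rw [← hu] at h
  rw [sub_mulVec, one_mulVec]
  simp only [dotProduct_sub, sub_dotProduct, h, dotProduct_comm v]
  ring

/-- An eigenvector of `XᵀX` with positive eigenvalue `c`, where `X = M Γᵀ + E`, is close to the span
of the columns of `Γ`. -/
theorem eigenvector_residual_le {Γ : Matrix (Fin p) (Fin d) ℝ} {M : Matrix (Fin n) (Fin d) ℝ}
    {E X : Matrix (Fin n) (Fin p) ℝ} (hX : X = M * Γᵀ + E) {c : ℝ} (hc : 0 < c) {v : Fin p → ℝ}
    (hv : (Xᵀ * X) *ᵥ v = c • v) :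
    c * (((1 - projMatrix Γ) *ᵥ v) ⬝ᵥ ((1 - projMatrix Γ) *ᵥ v)) ≤ frobSq E * (v ⬝ᵥ v) := by
  set Q := 1 - projMatrix Γ with hQ
  have hQX : Q * Xᵀ = Q * Eᵀ := by
    have : Q * Γ = 0 := by rw [hQ, Matrix.sub_mul, projMatrix_mul_self, Matrix.one_mul, sub_self]
    rw [hX, transpose_add, transpose_mul, transpose_transpose, Matrix.mul_add, ← Matrix.mul_assoc,
      this, Matrix.zero_mul, zero_add]
  have h1 : c • (Q *ᵥ v) = Q *ᵥ (Eᵀ *ᵥ (X *ᵥ v)) := by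
    rw [← mulVec_smul, ← hv, mulVec_mulVec, mulVec_mulVec, mulVec_mulVec, ← hQX, Matrix.mul_assoc]
  have hXv : (X *ᵥ v) ⬝ᵥ (X *ᵥ v) = c * (v ⬝ᵥ v) := by
    rw [← dotProduct_mulVec_mulVec, hv, dotProduct_smul, smul_eq_mul]
  -- Pythagoras gives `c² ‖Qv‖² ≤ ‖Eᵀ X v‖² ≤ ‖E‖² c ‖v‖²`; one factor `c` cancels.
  have h2 := dotProduct_self_projMatrix_add Γ (Eᵀ *ᵥ (X *ᵥ v))
  rw [← hQ, ← h1] at h2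
  have h3 := dotProduct_mulVec_self_le Eᵀ (X *ᵥ v)
  rw [frobSq_transpose, hXv] at h3
  have h4 := zero_le_dotProduct_self (projMatrix Γ *ᵥ (Eᵀ *ᵥ (X *ᵥ v)))
  simp only [dotProduct_smul, smul_dotProduct, smul_eq_mul] at h2
  refine le_of_mul_le_mul_left ?_ hc
  linarith

theorem dotProduct_eq_sum_eigenvectorBasis {A : Matrix (Fin p) (Fin p) ℝ} (hA : A.IsHermitian)
    (w x : Fin p → ℝ) : w ⬝ᵥ x =
      ∑ i, ((hA.eigenvectorBasis i).ofLp ⬝ᵥ w) * ((hA.eigenvectorBasis i).ofLp ⬝ᵥ x) := by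
  have := hA.eigenvectorBasis.sum_inner_mul_inner (WithLp.toLp 2 w) (WithLp.toLp 2 x)
  simp only [EuclideanSpace.inner_eq_star_dotProduct, star_trivial] at this
  rw [dotProduct_comm, ← this]
  refine Finset.sum_congr rfl fun i _ => ?_
  rw [dotProduct_comm x]

theorem eigenvectorBasis_dotProduct_mulVec {A : Matrix (Fin p) (Fin p) ℝ} (hA : A.IsHermitian)
    (w : Fin p → ℝ) (i : Fin p) : (hA.eigenvectorBasis i).ofLp ⬝ᵥ (A *ᵥ w) =
      hA.eigenvalues i * ((hA.eigenvectorBasis i).ofLp ⬝ᵥ w) := by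
  have hAt : Aᵀ = A := by simpa using hA.eq
  rw [dotProduct_mulVec, ← mulVec_transpose, hAt, hA.mulVec_eigenvectorBasis, smul_dotProduct,
    smul_eq_mul]

/-- The half of the min-max principle that bounds eigenvalues from below. -/
theorem le_sortedEigenvalue {A : Matrix (Fin p) (Fin p) ℝ} (hA : A.IsHermitian)
    (B : Matrix (Fin p) (Fin d) ℝ) (hdp : d ≤ p) {c : ℝ}
    (hB : ∀ u, u ≠ 0 → 0 < (B *ᵥ u) ⬝ᵥ (B *ᵥ u))
    (h : ∀ u, c * ((B *ᵥ u) ⬝ᵥ (B *ᵥ u)) ≤ (B *ᵥ u) ⬝ᵥ (A *ᵥ (B *ᵥ u))) (j : Fin d) :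
    c ≤ sortedEigenvalue hA (Fin.castLE hdp j) := by
  set lam := sortedEigenvalue hA (Fin.castLE hdp j) with hlam
  let e := hA.eigenvectorBasis
  -- `eigenvalues i` is `eigenvalues₀ (idx i)`, so `idx i` is the rank of the `i`-th basis vector in
  -- decreasing order.
  let idx : Fin p → Fin (Fintype.card (Fin p)) := fun i =>
    (Fintype.equivOfCardEq (Fintype.card_fin (Fintype.card (Fin p)))).symm i
  let idxInv : Fin (Fintype.card (Fin p)) → Fin p :=
    Fintype.equivOfCardEq (Fintype.card_fin (Fintype.card (Fin p)))
  -- Counting from zero, `j` eigenvectors precede the one for `lam`. Orthogonality of `B u` to them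
  -- is `j < d` linear conditions on `u`, so some nonzero `u` satisfies all of them.
  let L : (Fin d → ℝ) →ₗ[ℝ] (Fin j → ℝ) := LinearMap.pi fun i =>
    (dotProductBilin ℝ ℝ (e (idxInv ⟨i, by have := i.2; have := j.2; simp; omega⟩)).ofLp) ∘ₗ
      B.mulVecLin
  have hker : LinearMap.ker L ≠ ⊥ := LinearMap.ker_ne_bot_of_finrank_lt (by simp)
  obtain ⟨u, hu, hu0⟩ := Submodule.exists_mem_ne_zero_of_ne_bot hker
  set w := B *ᵥ u with hw
  have hort : ∀ i : Fin p, (idx i : ℕ) < j → (e i).ofLp ⬝ᵥ w = 0 := by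
    intro i hi
    have := congrFun (LinearMap.mem_ker.1 hu) ⟨idx i, hi⟩
    have h2 : idxInv (idx i) = i := by simp [idx, idxInv]
    simpa [L, h2] using this
  have hup : w ⬝ᵥ (A *ᵥ w) ≤ lam * (w ⬝ᵥ w) := by
    rw [dotProduct_eq_sum_eigenvectorBasis hA w (A *ᵥ w), dotProduct_eq_sum_eigenvectorBasis hA w w,
      Finset.mul_sum]
    refine Finset.sum_le_sum fun i _ => ?_
    rw [eigenvectorBasis_dotProduct_mulVec]
    by_cases hi : (idx i : ℕ) < j
    · simp only [e] at hort
      simp [hort i hi]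
    · have : hA.eigenvalues i ≤ lam := by
        apply hA.eigenvalues₀_antitone
        rw [Fin.le_def]
        simpa using not_lt.1 hi
      nlinarith [mul_self_nonneg ((hA.eigenvectorBasis i).ofLp ⬝ᵥ w)]
  exact le_of_mul_le_mul_right ((h u).trans hup) (hB u hu0)

end Spectral
-- Deterministic bound on the angle.
section Estimate

variable {n p d r : ℕ}

/-- Centring changes each column by a constant, and `P_F` kills constant columns because they are
orthogonal to the columns of `F`. -/
theorem fitted_observations (μ : Fin p → ℝ) (Γ : Matrix (Fin p) (Fin d) ℝ)
    (β : Matrix (Fin d) (Fin r) ℝ) (σ : ℝ) {F : Matrix (Fin n) (Fin r) ℝ}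
    (ε : Matrix (Fin n) (Fin p) ℝ) (hF : ∀ k, ∑ i, F i k = 0) :
    fitted F (observations μ Γ β σ F ε) = (F * βᵀ) * Γᵀ + σ • (projMatrix F * ε) := by
  set X := observations μ Γ β σ F ε with hX
  have hc : centred X = F * (βᵀ * Γᵀ) + σ • ε +
      vecMulVec (fun _ => 1) (fun k => μ k - (∑ j, X j k) / n) := by
    ext i k
    have : ((Γ * β) *ᵥ F i) k = (F * (βᵀ * Γᵀ)) i k := by
      rw [← transpose_mul]
      simp [mulVec, dotProduct, Matrix.mul_apply, mul_comm]
    simp only [centred, Matrix.of_apply, Matrix.add_apply, Matrix.smul_apply, vecMulVec_apply,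
      one_mul, smul_eq_mul, ← this]
    rw [show X i k = μ k + ((Γ * β) *ᵥ F i) k + σ * ε i k by simp [hX, observations]]
    ring
  have h1 : projMatrix F *ᵥ (fun _ => 1) = 0 := by
    refine projMatrix_mulVec_eq_zero F ?_
    ext k
    simpa [mulVec, dotProduct] using hF k
  rw [fitted, hc, Matrix.mul_add, Matrix.mul_add, ← Matrix.mul_assoc, projMatrix_mul_self,
    mul_vecMulVec, h1, zero_vecMulVec, add_zero, Matrix.mul_smul, Matrix.mul_assoc]

theorem frobSq_projMatrix_add (Γ G : Matrix (Fin p) (Fin d) ℝ) :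
    frobSq (projMatrix Γ * G) + frobSq ((1 - projMatrix Γ) * G) = frobSq G := by
  simp only [frobSq_eq_sum_col, ← Finset.sum_add_distrib, mul_transpose_row,
    dotProduct_self_projMatrix_add]

/-- The hypothesis says `sin² ≤ t`. As `t ≤ 1/2`, `cos² ≥ 1/2`, hence `tan² ≤ 2t`, and an angle is
at most its tangent. -/
theorem angle_le_sqrt {Γ G : Matrix (Fin p) (Fin d) ℝ} {t : ℝ} (ht : t ≤ 1 / 2)
    (hG : 0 < frobSq G) (h : frobSq ((1 - projMatrix Γ) * G) ≤ t * frobSq G) :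
    angle G Γ ≤ √(2 * t) := by
  have hadd := frobSq_projMatrix_add Γ G
  set a := frobSq (projMatrix Γ * G) with ha
  set b := frobSq ((1 - projMatrix Γ) * G) with hb
  have hb0 : 0 ≤ b := frobSq_nonneg _
  have hapos : 0 < a := by nlinarith
  have ht0 : 0 ≤ t := by
    by_contra hneg
    nlinarith
  have hclose : closeness G Γ ≠ 0 := by
    rw [closeness, ← ha, ← hb]
    simp [ENNReal.div_eq_zero_iff, hapos]
  have hinv : ((closeness G Γ)⁻¹).toReal = b / a := by
    rw [closeness, ← ha, ← hb, ENNReal.inv_div (by simp) (by simp [hapos]), ENNReal.toReal_div,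
      ENNReal.toReal_ofReal hb0, ENNReal.toReal_ofReal hapos.le]
  rw [angle, if_neg hclose, hinv]
  have hle : b / a ≤ 2 * t := by
    rw [div_le_iff₀ hapos]
    nlinarith
  have harctan : Real.arctan (√(b / a)) ≤ √(b / a) := by
    conv_rhs => rw [← Real.tan_arctan (√(b / a))]
    exact Real.le_tan (Real.arctan_nonneg.2 (Real.sqrt_nonneg _)) (Real.arctan_lt_pi_div_two _)
  exact harctan.trans (Real.sqrt_le_sqrt hle)

theorem angle_le_pi_div_two (Γ G : Matrix (Fin p) (Fin d) ℝ) : angle G Γ ≤ Real.pi / 2 := by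
  rw [angle]
  split_ifs
  · exact le_rfl
  · exact (Real.arctan_lt_pi_div_two _).le

theorem frobSq_pos_of_linearIndependent {G : Matrix (Fin p) (Fin d) ℝ} (hd : 0 < d)
    (hG : LinearIndependent ℝ Gᵀ) : 0 < frobSq G := by
  rw [frobSq_eq_sum_col]
  refine Finset.sum_pos' (fun j _ => zero_le_dotProduct_self _) ⟨⟨0, hd⟩, Finset.mem_univ _, ?_⟩
  exact lt_of_le_of_ne (zero_le_dotProduct_self _)
    fun h => hG.ne_zero ⟨0, hd⟩ (dotProduct_self_eq_zero.1 h.symm)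

/-- A lower bound for the leading eigenvalues of the fitted sample covariance matrix. -/
theorem le_sortedEigenvalue_fittedCov (hdp : d ≤ p) {Γ : Matrix (Fin p) (Fin d) ℝ}
    (hΓ : Γᵀ * Γ = 1) {M : Matrix (Fin n) (Fin d) ℝ} {E : Matrix (Fin n) (Fin p) ℝ}
    {F : Matrix (Fin n) (Fin r) ℝ} {X : Matrix (Fin n) (Fin p) ℝ}
    (hX : fitted F X = M * Γᵀ + E) {c : ℝ}
    (hM : ∀ u, 4 * c * (u ⬝ᵥ u) ≤ (M *ᵥ u) ⬝ᵥ (M *ᵥ u)) (hE : frobSq E ≤ c) (j : Fin d) :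
    c ≤ sortedEigenvalue (fittedCov_isHermitian F X) (Fin.castLE hdp j) := by
  refine le_sortedEigenvalue _ Γ hdp (fun u hu => ?_) (fun u => ?_) j
  · rw [dotProduct_self_mulVec_of_orthonormal hΓ]
    exact lt_of_le_of_ne (zero_le_dotProduct_self _)
      fun h => hu (dotProduct_self_eq_zero.1 h.symm)
  · rw [fittedCov, dotProduct_mulVec_mulVec, dotProduct_self_mulVec_of_orthonormal hΓ, hX,
      add_mulVec, mulVec_mulVec, Matrix.mul_assoc, hΓ, Matrix.mul_one]
    have h1 := dotProduct_mulVec_self_le E (Γ *ᵥ u)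
    rw [dotProduct_self_mulVec_of_orthonormal hΓ] at h1
    have h2 := hM u
    -- With `e = E Γ u`, this square yields `‖Mu + e‖² ≥ ‖Mu‖²/2 - ‖e‖² ≥ (2c - c) ‖u‖²`, whence the
    -- factor 4 in `hM`.
    have h3 := zero_le_dotProduct_self (M *ᵥ u + (2 : ℝ) • (E *ᵥ (Γ *ᵥ u)))
    have h4 := mul_le_mul_of_nonneg_right hE (zero_le_dotProduct_self u)
    simp only [dotProduct_add, add_dotProduct, dotProduct_smul, smul_dotProduct, smul_eq_mul,
      dotProduct_comm (E *ᵥ (Γ *ᵥ u)) (M *ᵥ u)] at h3 ⊢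
    linarith

/-- The angle between a PFC estimate and `Γ` is small if the signal is large compared with the
projected errors. -/
theorem angle_le_of_isPFCEstimate (hd : 0 < d) (hdp : d ≤ p) {μ : Fin p → ℝ}
    {Γ : Matrix (Fin p) (Fin d) ℝ} (hΓ : Γᵀ * Γ = 1) {β : Matrix (Fin d) (Fin r) ℝ} {σ : ℝ}
    {F : Matrix (Fin n) (Fin r) ℝ} {ε : Matrix (Fin n) (Fin p) ℝ} (hF : ∀ k, ∑ i, F i k = 0)
    {G : Matrix (Fin p) (Fin d) ℝ} (hG : IsPFCEstimate hdp F (observations μ Γ β σ F ε) G)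
    {c K : ℝ} (hc : 0 < c)
    (hβ : ∀ u, 4 * c * (u ⬝ᵥ u) ≤ u ⬝ᵥ ((β * (Fᵀ * F) * βᵀ) *ᵥ u))
    (hε : frobSq (projMatrix F * ε) ≤ K) (hK : 2 * (σ ^ 2 * K) ≤ c) :
    angle G Γ ≤ √(2 * (σ ^ 2 * K / c)) := by
  have hX := fitted_observations μ Γ β σ ε hF
  set X := observations μ Γ β σ F ε
  have hK0 : 0 ≤ K := (frobSq_nonneg _).trans hε
  have hσK : 0 ≤ σ ^ 2 * K := by positivity
  have hE : frobSq (σ • (projMatrix F * ε)) ≤ σ ^ 2 * K := by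
    rw [frobSq_smul]
    exact mul_le_mul_of_nonneg_left hε (sq_nonneg σ)
  have hM : ∀ u, 4 * c * (u ⬝ᵥ u) ≤ ((F * βᵀ) *ᵥ u) ⬝ᵥ ((F * βᵀ) *ᵥ u) := by
    intro u
    rw [← dotProduct_mulVec_mulVec, transpose_mul, transpose_transpose, Matrix.mul_assoc]
    simpa only [Matrix.mul_assoc] using hβ u
  have hlam := le_sortedEigenvalue_fittedCov hdp hΓ hX hM (by linarith)
  refine angle_le_sqrt ?_ (frobSq_pos_of_linearIndependent hd hG.1) ?_
  · rw [div_le_iff₀ hc]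
    linarith
  · rw [div_mul_eq_mul_div, le_div_iff₀' hc, frobSq_eq_sum_col, frobSq_eq_sum_col G, Finset.mul_sum,
      Finset.mul_sum]
    refine Finset.sum_le_sum fun j _ => ?_
    rw [mul_transpose_row]
    refine (mul_le_mul_of_nonneg_right (hlam j) (zero_le_dotProduct_self _)).trans ?_
    refine (eigenvector_residual_le hX (hc.trans_le (hlam j)) (hG.2 j)).trans ?_
    exact mul_le_mul_of_nonneg_right hE (zero_le_dotProduct_self _)

/-- A positive definite form dominates a multiple of the squared Euclidean norm, uniformly in a
neighbourhood. -/
theorem exists_pos_forall_le_of_posDef {Φ : Matrix (Fin d) (Fin d) ℝ} (hΦ : Φ.PosDef) :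
    ∃ c : ℝ, 0 < c ∧ ∀ A : Matrix (Fin d) (Fin d) ℝ, frobSq (A - Φ) ≤ c ^ 2 →
      ∀ u, c * (u ⬝ᵥ u) ≤ u ⬝ᵥ (A *ᵥ u) := by
  obtain ⟨c, hc, hcΦ⟩ : ∃ c : ℝ, 0 < c ∧ ∀ u, 2 * c * (u ⬝ᵥ u) ≤ u ⬝ᵥ (Φ *ᵥ u) := by
    obtain ⟨c, hc, hcl⟩ : ∃ c : ℝ, 0 < c ∧ ∀ i, c ≤ hΦ.isHermitian.eigenvalues i := by
      rcases isEmpty_or_nonempty (Fin d) with h | h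
      · exact ⟨1, one_pos, fun i => h.elim i⟩
      · obtain ⟨i, hi⟩ := Finite.exists_min hΦ.isHermitian.eigenvalues
        exact ⟨_, hΦ.eigenvalues_pos i, hi⟩
    refine ⟨c / 2, half_pos hc, fun u => ?_⟩
    rw [dotProduct_eq_sum_eigenvectorBasis hΦ.isHermitian u (Φ *ᵥ u),
      dotProduct_eq_sum_eigenvectorBasis hΦ.isHermitian u u, Finset.mul_sum]
    refine Finset.sum_le_sum fun i _ => ?_
    rw [eigenvectorBasis_dotProduct_mulVec]
    nlinarith [hcl i, mul_self_nonneg ((hΦ.isHermitian.eigenvectorBasis i).ofLp ⬝ᵥ u)]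
  refine ⟨c, hc, fun A hA u => ?_⟩
  have h0 := zero_le_dotProduct_self u
  have h1 := dotProduct_mulVec_self_le (A - Φ) u
  -- With `D = A - Φ`, this square gives `2c ⟨u, Du⟩ ≥ -‖Du‖² - c² ‖u‖² ≥ -2c² ‖u‖²`, so perturbing
  -- by `D` costs at most half of the margin `2c`.
  have h2 := zero_le_dotProduct_self ((A - Φ) *ᵥ u + c • u)
  have h3 : u ⬝ᵥ (A *ᵥ u) = u ⬝ᵥ (Φ *ᵥ u) + u ⬝ᵥ ((A - Φ) *ᵥ u) := by
    rw [sub_mulVec, dotProduct_sub]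
    ring
  have h4 := mul_le_mul_of_nonneg_right hA h0
  simp only [dotProduct_add, add_dotProduct, dotProduct_smul, smul_dotProduct, smul_eq_mul,
    dotProduct_comm ((A - Φ) *ᵥ u) u] at h2
  have h5 : 0 ≤ c * (2 * (c * (u ⬝ᵥ u)) + 2 * (u ⬝ᵥ ((A - Φ) *ᵥ u))) := by nlinarith
  have h6 := nonneg_of_mul_nonneg_right h5 hc
  have h7 := hcΦ u
  linarith

end Estimate
-- Measurability, Gaussian moments and tail bounds.
section Probability

variable {n p r : ℕ}

/-- `P_G` is discontinuous in `G` where the rank drops. But `‖P_G x‖²` is the supremum over `u` of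
`2⟨Gu, x⟩ - ‖Gu‖²`, attained at `Gu = P_G x`, and by continuity in `u` a countable dense set
suffices. Fubini in the tail bound needs this joint measurability. -/
theorem measurable_dotProduct_projMatrix_mulVec :
    Measurable fun z : (Fin n × Fin r → ℝ) × (Fin n → ℝ) =>
      (projMatrix (Matrix.of (Function.curry z.1)) *ᵥ z.2) ⬝ᵥ
        (projMatrix (Matrix.of (Function.curry z.1)) *ᵥ z.2) := by
  refine measurable_of_Ioi fun a => ?_
  let φ : (Fin r → ℝ) → (Fin n × Fin r → ℝ) × (Fin n → ℝ) → ℝ := fun u z =>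
    2 * ((Matrix.of (Function.curry z.1) *ᵥ u) ⬝ᵥ z.2) -
      (Matrix.of (Function.curry z.1) *ᵥ u) ⬝ᵥ (Matrix.of (Function.curry z.1) *ᵥ u)
  have hφm : ∀ u, Measurable (φ u) := fun u => by
    simp only [φ, mulVec, dotProduct, Matrix.of_apply, Function.curry_apply]
    fun_prop
  have hφc : ∀ z, Continuous fun u => φ u z := fun z => by
    simp only [φ, mulVec, dotProduct, Matrix.of_apply, Function.curry_apply]
    fun_prop
  have hset : (fun z : (Fin n × Fin r → ℝ) × (Fin n → ℝ) =>
      (projMatrix (Matrix.of (Function.curry z.1)) *ᵥ z.2) ⬝ᵥ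
        (projMatrix (Matrix.of (Function.curry z.1)) *ᵥ z.2)) ⁻¹' Set.Ioi a =
      ⋃ q : ℕ, {z | a < φ (TopologicalSpace.denseSeq (Fin r → ℝ) q) z} := by
    ext z
    simp only [Set.mem_preimage, Set.mem_Ioi, Set.mem_iUnion, Set.mem_ofPred_eq]
    set G : Matrix (Fin n) (Fin r) ℝ := Matrix.of (Function.curry z.1) with hG
    have hφz : ∀ u, φ u z = 2 * ((G *ᵥ u) ⬝ᵥ (projMatrix G *ᵥ z.2)) - (G *ᵥ u) ⬝ᵥ (G *ᵥ u) :=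
      fun u => by rw [dotProduct_projMatrix_mulVec]
    constructor
    · intro h
      obtain ⟨u, hu⟩ := exists_projMatrix_mulVec G z.2
      have hau : a < φ u z := by
        rw [hφz, ← hu]
        linarith
      exact (TopologicalSpace.denseRange_denseSeq (Fin r → ℝ)).exists_mem_open
        (isOpen_lt continuous_const (hφc z)) ⟨u, hau⟩
    · rintro ⟨q, hq⟩
      rw [hφz] at hq
      have h0 := zero_le_dotProduct_self
        (projMatrix G *ᵥ z.2 - G *ᵥ (TopologicalSpace.denseSeq (Fin r → ℝ) q))
      simp only [dotProduct_sub, sub_dotProduct, dotProduct_comm (projMatrix G *ᵥ z.2) (G *ᵥ _)]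
        at h0
      linarith
  rw [hset]
  exact MeasurableSet.iUnion fun q => measurableSet_lt measurable_const (hφm _)

theorem measurable_frobSq_projMatrix_mul :
    Measurable fun z : (Fin n × Fin r → ℝ) × (Fin n × Fin p → ℝ) =>
      frobSq (projMatrix (Matrix.of (Function.curry z.1)) * Matrix.of (Function.curry z.2)) := by
  simp only [frobSq_eq_sum_col, mul_transpose_row]
  refine Finset.measurable_sum _ fun j _ => ?_
  exact measurable_dotProduct_projMatrix_mulVec.comp
    (f := fun z : (Fin n × Fin r → ℝ) × (Fin n × Fin p → ℝ) => (z.1, fun i => z.2 (i, j)))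
    (by fun_prop)

variable {Ω : Type*} [MeasurableSpace Ω] {P : Measure Ω}
  {ε : Ω → Matrix (Fin n) (Fin p) ℝ}

theorem integrable_mul_of_gaussian
    (hε_law : ∀ i k, HasLaw (fun ω => ε ω i k) (gaussianReal 0 1) P) (i j : Fin n) (k : Fin p) :
    Integrable (fun ω => ε ω i k * ε ω j k) P := by
  have h : ∀ i, MemLp (fun ω => ε ω i k) 2 P := fun i => by
    have := memLp_id_gaussianReal (μ := 0) (v := 1) 2
    rw [← (hε_law i k).map_eq] at this
    exact (memLp_map_measure_iff aestronglyMeasurable_id (hε_law i k).aemeasurable).1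
      (by exact_mod_cast this)
  exact (h i).integrable_mul (h j)

theorem integral_mul_of_gaussian
    (hε_law : ∀ i k, HasLaw (fun ω => ε ω i k) (gaussianReal 0 1) P)
    (hε_indep : iIndepFun (fun (q : Fin n × Fin p) ω => ε ω q.1 q.2) P)
    (i j : Fin n) (k : Fin p) :
    ∫ ω, ε ω i k * ε ω j k ∂P = if i = j then 1 else 0 := by
  have hmean : ∀ i, ∫ ω, ε ω i k ∂P = 0 := fun i => by
    rw [(hε_law i k).integral_eq, integral_id_gaussianReal]
  split_ifs with hij
  · subst hij
    have hv := (hε_law i k).variance_eq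
    rw [variance_id_gaussianReal,
      variance_of_integral_eq_zero (hε_law i k).aemeasurable (hmean i)] at hv
    simpa [sq] using hv
  · have hind : IndepFun (fun ω => ε ω i k) (fun ω => ε ω j k) P :=
      hε_indep.indepFun (i := (i, k)) (j := (j, k)) (by simpa using hij)
    have := hind.integral_mul_eq_mul_integral (hε_law i k).aemeasurable.aestronglyMeasurable
      (hε_law j k).aemeasurable.aestronglyMeasurable
    simpa [hmean] using this

/-- The second moment of a fixed linear transformation of a matrix of standard normal errors. -/
theorem lintegral_frobSq_mul_of_gaussian
    (hε_law : ∀ i k, HasLaw (fun ω => ε ω i k) (gaussianReal 0 1) P)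
    (hε_indep : iIndepFun (fun (q : Fin n × Fin p) ω => ε ω q.1 q.2) P)
    (B : Matrix (Fin n) (Fin n) ℝ) :
    ∫⁻ ω, ENNReal.ofReal (frobSq (B * ε ω)) ∂P = ENNReal.ofReal (p * frobSq B) := by
  have hexp : ∀ ω, frobSq (B * ε ω) =
      ∑ i, ∑ k, ∑ j, ∑ l, B i j * B i l * (ε ω j k * ε ω l k) := fun ω => by
    rw [frobSq_eq_sum_sq]
    refine Finset.sum_congr rfl fun i _ => Finset.sum_congr rfl fun k _ => ?_
    rw [Matrix.mul_apply, sq, Finset.sum_mul_sum]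
    refine Finset.sum_congr rfl fun j _ => Finset.sum_congr rfl fun l _ => ?_
    ring
  have hint : ∀ i k j l, Integrable (fun ω => B i j * B i l * (ε ω j k * ε ω l k)) P :=
    fun i k j l => (integrable_mul_of_gaussian hε_law j l k).const_mul _
  have hI : Integrable (fun ω => frobSq (B * ε ω)) P := by
    simp only [hexp]
    exact integrable_finsetSum _ fun i _ => integrable_finsetSum _ fun k _ =>
      integrable_finsetSum _ fun j _ => integrable_finsetSum _ fun l _ => hint i k j l
  rw [← ofReal_integral_eq_lintegral_ofReal hI (ae_of_all _ fun ω => frobSq_nonneg _)]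
  congr 1
  simp only [hexp]
  rw [integral_finsetSum _ fun i _ => integrable_finsetSum _ fun k _ =>
      integrable_finsetSum _ fun j _ => integrable_finsetSum _ fun l _ => hint i k j l,
    frobSq_eq_sum_sq, Finset.mul_sum]
  refine Finset.sum_congr rfl fun i _ => ?_
  rw [integral_finsetSum _ fun k _ => integrable_finsetSum _ fun j _ =>
    integrable_finsetSum _ fun l _ => hint i k j l]
  rw [show (p : ℝ) * ∑ j, B i j ^ 2 = ∑ _k : Fin p, ∑ j, B i j ^ 2 by simp]
  refine Finset.sum_congr rfl fun k _ => ?_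
  rw [integral_finsetSum _ fun j _ => integrable_finsetSum _ fun l _ => hint i k j l]
  refine Finset.sum_congr rfl fun j _ => ?_
  rw [integral_finsetSum _ fun l _ => hint i k j l]
  simp [integral_const_mul, integral_mul_of_gaussian hε_law hε_indep, sq]

/-- A tail bound for the projection of the errors onto the span of an independent design. -/
theorem measure_le_frobSq_projMatrix_mul_le [IsProbabilityMeasure P]
    {F : Ω → Matrix (Fin n) (Fin r) ℝ}
    (hF_meas : ∀ i k, AEMeasurable (fun ω => F ω i k) P)
    (hε_law : ∀ i k, HasLaw (fun ω => ε ω i k) (gaussianReal 0 1) P)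
    (hε_indep : iIndepFun (fun (q : Fin n × Fin p) ω => ε ω q.1 q.2) P)
    (hFε : IndepFun (fun ω (q : Fin n × Fin r) => F ω q.1 q.2)
      (fun ω (q : Fin n × Fin p) => ε ω q.1 q.2) P) {K : ℝ} (hK : 0 < K) :
    P {ω | K ≤ frobSq (projMatrix (F ω) * ε ω)} ≤ ENNReal.ofReal (p * r / K) := by
  have hFm : AEMeasurable (fun ω (q : Fin n × Fin r) => F ω q.1 q.2) P :=
    aemeasurable_pi_lambda _ fun q => hF_meas q.1 q.2
  have hεm : AEMeasurable (fun ω (q : Fin n × Fin p) => ε ω q.1 q.2) P :=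
    aemeasurable_pi_lambda _ fun q => (hε_law q.1 q.2).aemeasurable
  obtain ⟨H, hH, hHval⟩ : ∃ H : (Fin n × Fin r → ℝ) × (Fin n × Fin p → ℝ) → ℝ≥0∞, Measurable H ∧
      ∀ (A : Matrix (Fin n) (Fin r) ℝ) (B : Matrix (Fin n) (Fin p) ℝ),
        H (fun q => A q.1 q.2, fun q => B q.1 q.2) = ENNReal.ofReal (frobSq (projMatrix A * B)) :=
    ⟨_, measurable_frobSq_projMatrix_mul.ennreal_ofReal, fun _ _ => rfl⟩
  have hbound : ∫⁻ ω, H (fun q => F ω q.1 q.2, fun q => ε ω q.1 q.2) ∂P ≤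
      ENNReal.ofReal (p * r) := by
    rw [← lintegral_map' hH.aemeasurable (hFm.prodMk hεm),
      (indepFun_iff_map_prod_eq_prod_map_map hFm hεm).1 hFε]
    have := Measure.isProbabilityMeasure_map hFm
    have := Measure.isProbabilityMeasure_map hεm
    -- By independence the design can be frozen at `f`; the inner integral is then `p ‖P_f‖² ≤ p r`.
    rw [lintegral_prod _ hH.aemeasurable]
    refine (lintegral_mono (g := fun _ => ENNReal.ofReal (p * r)) fun f => ?_).trans (by simp)
    rw [lintegral_map' (f := fun y => H (f, y)) (hH.comp measurable_prodMk_left).aemeasurable hεm]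
    have hf : ∀ ω, H (f, fun q => ε ω q.1 q.2) =
        ENNReal.ofReal (frobSq (projMatrix (Matrix.of (Function.curry f)) * ε ω)) :=
      fun ω => hHval (Matrix.of (Function.curry f)) (ε ω)
    simp only [hf]
    rw [lintegral_frobSq_mul_of_gaussian hε_law hε_indep]
    exact ENNReal.ofReal_le_ofReal
      (mul_le_mul_of_nonneg_left (frobSq_projMatrix_le _) (Nat.cast_nonneg _))
  have hmarkov := meas_ge_le_lintegral_div (μ := P) (hH.comp_aemeasurable (hFm.prodMk hεm))
    (ε := ENNReal.ofReal K) (by simpa using hK) (by simp)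
  rw [ENNReal.ofReal_div_of_pos hK]
  refine le_trans (measure_mono fun ω hω => ?_)
    (hmarkov.trans (ENNReal.div_le_div_right hbound _))
  exact (ENNReal.ofReal_le_ofReal hω).trans_eq (hHval (F ω) (ε ω)).symm

/-- Almost sure convergence of random matrices implies convergence in probability. -/
theorem tendsto_measure_frobSq_sub [IsProbabilityMeasure P] {d : ℕ}
    {A : ℕ → Ω → Matrix (Fin d) (Fin d) ℝ}
    {Φ : Matrix (Fin d) (Fin d) ℝ} (hA : ∀ n i j, AEMeasurable (fun ω => A n ω i j) P)
    (hlim : ∀ᵐ ω ∂P, Tendsto (fun n => A n ω) atTop (𝓝 Φ)) {δ : ℝ} (hδ : 0 < δ) :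
    Tendsto (fun n => P {ω | δ ≤ frobSq (A n ω - Φ)}) atTop (𝓝 0) := by
  have hm : ∀ n, AEMeasurable (fun ω => frobSq (A n ω - Φ)) P := fun n => by
    simp only [frobSq_eq_sum_sq, Matrix.sub_apply]
    fun_prop
  have hconv : ∀ᵐ ω ∂P, Tendsto (fun n => frobSq (A n ω - Φ)) atTop (𝓝 ((fun _ => 0) ω)) := by
    filter_upwards [hlim] with ω hω
    have hc : Continuous fun B : Matrix (Fin d) (Fin d) ℝ => frobSq (B - Φ) := by
      unfold frobSq
      fun_prop
    have := (hc.tendsto Φ).comp hω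
    rwa [sub_self, show frobSq (0 : Matrix (Fin d) (Fin d) ℝ) = 0 by simp [frobSq]] at this
  have := tendstoInMeasure_of_tendsto_ae (fun n => (hm n).aestronglyMeasurable) hconv
  have h2 := this (ENNReal.ofReal δ) (by simpa using hδ)
  refine h2.congr fun n => ?_
  congr 1
  ext ω
  rw [Set.mem_ofPred_eq, Set.mem_ofPred_eq, edist_dist, ENNReal.ofReal_le_ofReal_iff dist_nonneg,
    Real.dist_eq, sub_zero, abs_of_nonneg (frobSq_nonneg _)]

end Probability
end PFC

/-! ### Assembly of the main theorem. -/

theorem theorem4p3 {Ω : Type*} [MeasurableSpace Ω] (P : Measure Ω) [IsProbabilityMeasure P]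
    {p d r : ℕ} (hd : 0 < d) (hdp : d < p) (hdr : d ≤ r)
    (μ : Fin p → ℝ) (Γ : Matrix (Fin p) (Fin d) ℝ) (hΓ : Γᵀ * Γ = 1)
    (β : Matrix (Fin d) (Fin r) ℝ) (σ : ℝ)
    -- for each sample size `n`: the random `n × r` matrix with rows `f_yᵀ`, and the errors
    (F : (n : ℕ) → Ω → Matrix (Fin n) (Fin r) ℝ)
    (ε : (n : ℕ) → Ω → Matrix (Fin n) (Fin p) ℝ)
    (hF_meas : ∀ n i k, AEMeasurable (fun ω => F n ω i k) P)
    (hF_sum : ∀ n, ∀ᵐ ω ∂P, ∀ k, ∑ i, F n ω i k = 0)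
    (hε_law : ∀ n i k, HasLaw (fun ω => ε n ω i k) (gaussianReal 0 1) P)
    (hε_indep : ∀ n, iIndepFun (fun (q : Fin n × Fin p) ω => ε n ω q.1 q.2) P)
    (hFε : ∀ n, IndepFun (fun ω (q : Fin n × Fin r) => F n ω q.1 q.2)
      (fun ω (q : Fin n × Fin p) => ε n ω q.1 q.2) P)
    (Φ : Matrix (Fin d) (Fin d) ℝ)
    (hlim : ∀ᵐ ω ∂P, Tendsto (fun n : ℕ => (n : ℝ)⁻¹ • (β * ((F n ω)ᵀ * F n ω) * βᵀ))
      atTop (𝓝 Φ))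
    (hΦ : Φ.PosDef) (hΦ_distinct : Function.Injective hΦ.isHermitian.eigenvalues) :
    ∃ Θstar : ℝ → ℕ → ℝ, ∀ α : ℝ, 0 < α → α < 1 →
      (fun n : ℕ => Θstar α n) =O[atTop] (fun n : ℕ => 1 / Real.sqrt n) ∧
      ∀ (n : ℕ) (Ghat : Ω → Matrix (Fin p) (Fin d) ℝ),
        (∀ᵐ ω ∂P, PFC.IsPFCEstimate hdp.le (F n ω)
          (PFC.observations μ Γ β σ (F n ω) (ε n ω)) (Ghat ω)) →
        P {ω | Θstar α n ≤ PFC.angle (Ghat ω) Γ} ≤ ENNReal.ofReal α := by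
  suffices H : ∀ α : ℝ, 0 < α → α < 1 → ∃ θ : ℕ → ℝ,
      θ =O[atTop] (fun n : ℕ => 1 / Real.sqrt n) ∧
      ∀ (n : ℕ) (Ghat : Ω → Matrix (Fin p) (Fin d) ℝ),
        (∀ᵐ ω ∂P, PFC.IsPFCEstimate hdp.le (F n ω)
          (PFC.observations μ Γ β σ (F n ω) (ε n ω)) (Ghat ω)) →
        P {ω | θ n ≤ PFC.angle (Ghat ω) Γ} ≤ ENNReal.ofReal α by
    choose θ hθ using H
    refine ⟨fun α n => if h : 0 < α ∧ α < 1 then θ α h.1 h.2 n else 0, fun α h0 h1 => ?_⟩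
    simp only [dif_pos (And.intro h0 h1)]
    exact hθ α h0 h1
  intro α hα0 _
  obtain ⟨c, hc, hcΦ⟩ := PFC.exists_pos_forall_le_of_posDef hΦ
  -- Chosen so that Markov's bound `p r / K` is at most `α/2`; the added 1 makes positivity
  -- immediate.
  set K : ℝ := 2 * (p * r + 1) / α with hK
  have hKpos : 0 < K := by positivity
  have htail : (p * r / K : ℝ) ≤ α / 2 := by
    rw [hK, div_div_eq_mul_div, div_le_iff₀ (by positivity)]
    nlinarith
  have hA : ∀ (n : ℕ) i j, AEMeasurable
      (fun ω => ((n : ℝ)⁻¹ • (β * ((F n ω)ᵀ * F n ω) * βᵀ)) i j) P := fun n i j => by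
    have := hF_meas n
    simp only [Matrix.smul_apply, Matrix.mul_apply, Matrix.transpose_apply]
    fun_prop
  have hconv := PFC.tendsto_measure_frobSq_sub hA hlim (δ := c ^ 2) (by positivity)
  have hev1 := hconv.eventually_le_const (u := ENNReal.ofReal (α / 2)) (by simpa using hα0)
  -- This is `2σ²K ≤ n c/4`, where `n c/4` is the lower bound for the leading eigenvalues.
  have hev2 := (tendsto_natCast_atTop_atTop (R := ℝ)).eventually_ge_atTop
    (2 * (σ ^ 2 * K) / (c / 4))
  obtain ⟨N, hN⟩ := eventually_atTop.1 ((hev1.and hev2).and (eventually_gt_atTop 0))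
  -- The added 1 makes the angle strictly smaller than `C / √n` off the bad events, as the event to
  -- exclude has a weak inequality.
  set C : ℝ := √(8 * (σ ^ 2 * K) / c) + 1 with hC
  -- The value 2 exceeds `π/2`, so for `n < N` the event is empty; finitely many `n` do not affect
  -- the rate.
  refine ⟨fun n => if n < N then 2 else C / √n, ?_, fun n Ghat hGhat => ?_⟩
  · refine IsBigO.congr' (f₁ := fun n : ℕ => C * (1 / √n)) (g₁ := fun n : ℕ => 1 / √n)
      ((isBigO_refl _ _).const_mul_left C) ?_ EventuallyEq.rfl
    filter_upwards [eventually_ge_atTop N] with n hn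
    rw [if_neg hn.not_gt, mul_one_div]
  by_cases hn : n < N
  · have : {ω | (if n < N then 2 else C / √n) ≤ PFC.angle (Ghat ω) Γ} = ∅ := by
      refine Set.eq_empty_of_forall_notMem fun ω hω => ?_
      rw [Set.mem_ofPred_eq, if_pos hn] at hω
      linarith [PFC.angle_le_pi_div_two Γ (Ghat ω), Real.pi_lt_four]
    rw [this, measure_empty]
    exact zero_le
  obtain ⟨⟨h1, h2⟩, hn0⟩ := hN n (not_lt.1 hn)
  have hnpos : (0 : ℝ) < n := Nat.cast_pos.2 hn0
  rw [div_le_iff₀ (by positivity)] at h2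
  -- Only an almost sure inclusion in the two bad events is needed, so `Ghat` may be an arbitrary,
  -- possibly non-measurable, choice.
  have hgood : ∀ᵐ ω ∂P, ω ∈ {ω | (if n < N then 2 else C / √n) ≤ PFC.angle (Ghat ω) Γ} →
      ω ∈ {ω | K ≤ PFC.frobSq (PFC.projMatrix (F n ω) * ε n ω)} ∪
        {ω | c ^ 2 ≤ PFC.frobSq ((n : ℝ)⁻¹ • (β * ((F n ω)ᵀ * F n ω) * βᵀ) - Φ)} := by
    filter_upwards [hGhat, hF_sum n] with ω hG hF hω
    rw [if_neg hn] at hω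
    by_contra hnot
    simp only [Set.mem_union, Set.mem_ofPred_eq, not_or, not_le] at hnot
    have hβ : ∀ u, 4 * (n * (c / 4)) * (u ⬝ᵥ u) ≤
        u ⬝ᵥ ((β * ((F n ω)ᵀ * F n ω) * βᵀ) *ᵥ u) := fun u => by
      have := hcΦ _ hnot.2.le u
      rw [smul_mulVec, dotProduct_smul, smul_eq_mul, le_inv_mul_iff₀ hnpos] at this
      linarith
    have hangle := PFC.angle_le_of_isPFCEstimate hd hdp.le hΓ hF hG (by positivity) hβ hnot.1.le h2
    have hsqrt : √(2 * (σ ^ 2 * K / (n * (c / 4)))) = √(8 * (σ ^ 2 * K) / c) / √n := by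
      rw [← Real.sqrt_div' _ hnpos.le]
      congr 1
      field_simp
      ring
    have hlt : √(8 * (σ ^ 2 * K) / c) / √n < C / √n :=
      div_lt_div_of_pos_right (lt_add_one _) (Real.sqrt_pos.2 hnpos)
    linarith
  calc P {ω | (if n < N then 2 else C / √n) ≤ PFC.angle (Ghat ω) Γ}
      ≤ P ({ω | K ≤ PFC.frobSq (PFC.projMatrix (F n ω) * ε n ω)} ∪
        {ω | c ^ 2 ≤ PFC.frobSq ((n : ℝ)⁻¹ • (β * ((F n ω)ᵀ * F n ω) * βᵀ) - Φ)}) :=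
        measure_mono_ae hgood
    _ ≤ ENNReal.ofReal (α / 2) + ENNReal.ofReal (α / 2) :=
        (measure_union_le _ _).trans (add_le_add
          ((PFC.measure_le_frobSq_projMatrix_mul_le (hF_meas n) (hε_law n) (hε_indep n) (hFε n)
            hKpos).trans (ENNReal.ofReal_le_ofReal htail)) h1)
    _ = ENNReal.ofReal α := by
        rw [← ENNReal.ofReal_add (by positivity) (by positivity), add_halves]
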